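/- Let $\mathbb D$ be the open unit disc. For a complex Hilbert space $\mathcal K$ let $H^2(\mathbb D,\mathcal K)$ be the Hilbert space of power series $f(z)=\sum_{m\ge 0}A_mz^m$ with $A_m\in\mathcal K$ and $\|f\|_2^2=\sum_m\|A_m\|^2<\infty$. For a bounded analytic function $\varphi$ on $\mathbb D$, $T_\varphi$ denotes the bounded operator of multiplication by $\varphi$ on $H^2(\mathbb D,\mathcal K)$. An inner function is a bounded analytic function $\varphi$ on $\mathbb D$ with $\lim_{r\to1^-}|\varphi(re^{it})|=1$ for almost every $t$. Vector subspaces are not assumed to be closed. Let $\mathcal H$ be a reproducing kernel Hilbert space of analytic functions on $\mathbb D$ (that is, a Hilbert space of functions, with pointwise operations, on which all point evaluations are continuous). Let $\varphi$ be an inner function with $\varphi(0)=0$, $\varphi\mathcal H\subseteq\mathcal H$ and $\|h\|_{\mathcal H}\le\|\varphi h\|_{\mathcal H}$ for every $h\in\mathcal H$. Assume that whenever $h$ is analytic on $\mathbb D$ and $\varphi h\in\mathcal H$, then $h\in\mathcal H$. Let $\mathcal M$ be a Hilbert space contractively contained in $\mathcal H$, i.e. $\mathcal M$ is a vector subspace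 of $\mathcal H$ with its own Hilbert space norm satisfying $\|h\|_{\mathcal H}\le\|h\|_{\mathcal M}$ for $h\in\mathcal M$. Assume that $\mathcal M$ is nearly invariant under division by $\varphi$ with a defect space $\mathcal F$ of dimension $p$, i.e. $\mathcal F$ is a $p$-dimensional subspace of $\mathcal H$ ($0\le p<\infty$) with $\mathcal M\cap\mathcal F=\{0\}$, such that $f\in\mathcal H$ and $\varphi f\in\mathcal M$ imply $f\in\mathcal M+\mathcal F$. On $\mathcal M+\mathcal F$ put $\|h+f\|_\oplus^2=\|h\|_{\mathcal M}^2+\|f\|_{\mathcal H}^2$ ($h\in\mathcal M$, $f\in\mathcal F$), and assume that $\|\varphi h\|_{\mathcal M}\ge\|h\|_\oplus$ whenever $\varphi h\in\mathcal M$. 1. Suppose $\mathcal M\not\subseteq\varphi\mathcal H$. Let $\{g_i:i\in I\}$ be an orthonormal basis of the orthogonal complement $\mathcal M\ominus(\mathcal M\cap\varphi\mathcal H)$ in $\mathcal M$, and let $\{e_j:1\le j\le p\}$ be an orthonormal basis of $\mathcal F$ (with the norm of $\mathcal H$). Then there is a vector subspace $\mathcal N$ of $H^2(\mathbb D,\ell^2(I)\oplus\mathbb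 C^p)$, invariant under $T_\varphi^*$, and a linear bijection $\mathcal G:\mathcal N\to\mathcal M$ given by the pointwise formula $$\mathcal G(f,t)(z)=\sum_{i\in I}g_i(z)f_i(z)+\varphi(z)\sum_{j=1}^pe_j(z)t_j(z)\qquad(z\in\mathbb D),$$ where the sum over $I$ converges unconditionally at each $z$, and for all $(f,t)\in\mathcal N$ $$\|\mathcal G(f,t)\|_{\mathcal M}^2\ \ge\ \|(f,t)\|_2^2=\|f\|_2^2+\|t\|_2^2 .$$ 2. Suppose $\mathcal M\subseteq\varphi\mathcal H$. Let $\{e_j:1\le j\le p\}$ be an orthonormal basis of $\mathcal F$. Then there is a vector subspace $\mathcal N$ of $H^2(\mathbb D,\mathbb C^p)$, invariant under $T_\varphi^*$, and a linear bijection $\mathcal G:\mathcal N\to\mathcal M$ given by $$\mathcal G(t)(z)=\varphi(z)\sum_{j=1}^pe_j(z)t_j(z)\qquad(z\in\mathbb D),$$ and $\|\mathcal G(t)\|_{\mathcal M}\ge\|t\|_2$ for all $t\in\mathcal N$. -/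

import Mathlib

open Filter Topology MeasureTheory Complex
open scoped ComplexInnerProductSpace UnitDisc lp ENNReal

/-- A bounded analytic function on the open unit disc whose radial limits have modulus one almost
everywhere on the unit circle. Only the values of `φ` on the open disc matter. -/
structure IsInner (φ : ℂ → ℂ) : Prop where
  analytic : AnalyticOnNhd ℂ φ (Metric.ball 0 1)
  bounded : ∃ C : ℝ, ∀ z ∈ Metric.ball (0 : ℂ) 1, ‖φ z‖ ≤ C
  radial : ∀ᵐ t : ℝ ∂volume,
    Tendsto (fun r : ℝ => ‖φ (r * Complex.exp (t * Complex.I))‖) (𝓝[<] 1) (𝓝 1)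

/-- A function on the unit disc is analytic. -/
def IsAnalyticOnDisc (f : 𝔻 → ℂ) : Prop :=
  ∃ F : ℂ → ℂ, AnalyticOnNhd ℂ F (Metric.ball 0 1) ∧ ∀ z : 𝔻, F z = f z

/-- `k = φ f` pointwise on the unit disc. -/
def IsMul (φ : ℂ → ℂ) (f k : 𝔻 → ℂ) : Prop := ∀ z : 𝔻, k z = φ z * f z

/-! ### Vector-valued Hardy spaces -/

/-- The Hardy space `H²(𝔻, K)` of power series `∑ A_m z ^ m` with coefficients in `K` such that
`∑ ‖A_m‖ ^ 2 < ∞`, with `‖f‖ ^ 2 = ∑ ‖A_m‖ ^ 2`: an element is given by its sequence of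
Taylor coefficients. -/
abbrev HardySpace (K : Type*) [NormedAddCommGroup K] : Type _ := lp (fun _ : ℕ => K) 2

namespace HardySpace

/-- The value `f(z) = ∑ A_m z ^ m` of a Hardy space function at a point of the disc. -/
noncomputable def eval {K : Type*} [NormedAddCommGroup K] [InnerProductSpace ℂ K]
    (f : HardySpace K) (z : 𝔻) : K :=
  ∑' m : ℕ, (z : ℂ) ^ m • f m

/-- The power series of a Hardy space function converges at each point of the disc. -/
theorem hasSum_eval {K : Type*} [NormedAddCommGroup K] [InnerProductSpace ℂ K] [CompleteSpace K]
    (f : HardySpace K) (z : 𝔻) : HasSum (fun m : ℕ => (z : ℂ) ^ m • f m) (f.eval z) := by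
  apply Summable.hasSum
  refine Summable.of_norm_bounded (g := fun m => ‖(z : ℂ)‖ ^ m * ‖f‖)
    ((summable_geometric_of_lt_one (norm_nonneg _) z.norm_lt_one).mul_right _) fun m => ?_
  rw [norm_smul, norm_pow]
  gcongr
  exact lp.norm_apply_le_norm (by norm_num) f m

/-- Applying a bounded linear map `L` to the values (equivalently the coefficients) of a Hardy
space function. -/
def map {K K' : Type*} [NormedAddCommGroup K] [InnerProductSpace ℂ K]
    [NormedAddCommGroup K'] [InnerProductSpace ℂ K'] (L : K →L[ℂ] K')
    (f : HardySpace K) : HardySpace K' :=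
  ⟨fun m => L (f m), by
    have h := lp.memℓp f
    refine memℓp_gen ?_
    have h2 := (h.summable (by norm_num)).mul_left (‖L‖ ^ (2 : ℝ≥0∞).toReal)
    refine h2.of_nonneg_of_le (fun m => by positivity) fun m => ?_
    rw [← Real.mul_rpow (norm_nonneg _) (norm_nonneg _)]
    gcongr
    exact L.le_opNorm _⟩

theorem eval_map {K K' : Type*} [NormedAddCommGroup K] [InnerProductSpace ℂ K] [CompleteSpace K]
    [NormedAddCommGroup K'] [InnerProductSpace ℂ K'] [CompleteSpace K'] (L : K →L[ℂ] K')
    (f : HardySpace K) (z : 𝔻) : (f.map L).eval z = L (f.eval z) := by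
  have h := (f.hasSum_eval z).mapL L
  rw [← h.tsum_eq]
  simp [eval, map]

/-- `T` is the Toeplitz operator `T_φ`, i.e. the bounded operator of multiplication by `φ`
on `H²(𝔻, K)`. -/
def IsToeplitz {K : Type*} [NormedAddCommGroup K] [InnerProductSpace ℂ K]
    (φ : ℂ → ℂ) (T : HardySpace K →L[ℂ] HardySpace K) : Prop :=
  ∀ (f : HardySpace K) (z : 𝔻), (T f).eval z = φ z • f.eval z

/-- The vector subspace `N` of `H²(𝔻, K)` is invariant under the adjoint of `T_φ`; this includes
that `T_φ` is a bounded operator on `H²(𝔻, K)`. -/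
def InvariantToeplitzAdjoint {K : Type*} [NormedAddCommGroup K] [InnerProductSpace ℂ K]
    [CompleteSpace K] (φ : ℂ → ℂ) (N : Submodule ℂ (HardySpace K)) : Prop :=
  ∃ T : HardySpace K →L[ℂ] HardySpace K, IsToeplitz φ T ∧
    ∀ q ∈ N, ContinuousLinearMap.adjoint T q ∈ N

end HardySpace

/-- The Hilbert space direct sum `ℓ²(I) ⊕ ℂ^p`. -/
abbrev SumSpace (I : Type*) (p : ℕ) : Type _ :=
  WithLp 2 (lp (fun _ : I => ℂ) 2 × EuclideanSpace ℂ (Fin p))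

/-- The component `f` of `(f, t) ∈ H²(𝔻, ℓ²(I) ⊕ ℂ^p)`. -/
noncomputable def fstPart {I : Type*} {p : ℕ} (q : HardySpace (SumSpace I p)) :
    HardySpace (lp (fun _ : I => ℂ) 2) :=
  q.map (WithLp.fstL 2 ℂ (lp (fun _ : I => ℂ) 2) (EuclideanSpace ℂ (Fin p)))

/-- The component `t` of `(f, t) ∈ H²(𝔻, ℓ²(I) ⊕ ℂ^p)`. -/
noncomputable def sndPart {I : Type*} {p : ℕ} (q : HardySpace (SumSpace I p)) :
    HardySpace (EuclideanSpace ℂ (Fin p)) :=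
  q.map (WithLp.sndL 2 ℂ (lp (fun _ : I => ℂ) 2) (EuclideanSpace ℂ (Fin p)))

/-! ### Contractively contained spaces and defect spaces -/

section
variable {H M : Type*} [NormedAddCommGroup H] [InnerProductSpace ℂ H]
  [NormedAddCommGroup M] [InnerProductSpace ℂ M]

/-- The Hilbert space `M` is contractively contained in `H`, with inclusion map `j`. -/
structure IsContractivelyContained (j : M →ₗ[ℂ] H) : Prop where
  injective : Function.Injective j
  contractive : ∀ m : M, ‖j m‖ ≤ ‖m‖

/-- The map `(h, f) ↦ h + f` from the external Hilbert direct sum of `M` and `F` to `H`. If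
`M ∩ F = 0` it identifies `M ⊕ F` with `M + F`, and the norm of the source, given by
`‖(h, f)‖ ^ 2 = ‖h‖_M ^ 2 + ‖f‖_H ^ 2`, is the norm `‖h + f‖_⊕`. -/
def sumIncl (j : M →ₗ[ℂ] H) (F : Submodule ℂ H) (x : WithLp 2 (M × F)) : H :=
  j x.fst + x.snd

variable [RKHS ℂ H 𝔻 ℂ]

/-- The vector subspace `φ H ∩ H` of `H` (equal to `φ H` when `φ H ⊆ H`). -/
def mulRange (φ : ℂ → ℂ) (H : Type*) [NormedAddCommGroup H] [InnerProductSpace ℂ H]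
    [RKHS ℂ H 𝔻 ℂ] : Submodule ℂ H where
  carrier := {k | ∃ f : H, IsMul φ f k}
  add_mem' := by
    rintro a b ⟨f, hf⟩ ⟨g, hg⟩
    exact ⟨f + g, fun z => by simp [hf z, hg z, mul_add]⟩
  zero_mem' := ⟨0, fun z => by simp⟩
  smul_mem' := by
    rintro c a ⟨f, hf⟩
    exact ⟨c • f, fun z => by simp [hf z, mul_left_comm]⟩

/-- The vector subspace `M ∩ φ H` of `M`. -/
def interMulRange (φ : ℂ → ℂ) (j : M →ₗ[ℂ] H) : Submodule ℂ M := (mulRange φ H).comap j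

/-- `M` is nearly invariant under division by `φ` with defect space `F` of dimension `p`. -/
structure IsNearlyInvariantWithDefect (φ : ℂ → ℂ) (j : M →ₗ[ℂ] H) (F : Submodule ℂ H)
    (p : ℕ) : Prop where
  finiteDimensional : FiniteDimensional ℂ F
  finrank_eq : Module.finrank ℂ F = p
  disjoint : Disjoint (LinearMap.range j) F
  division : ∀ (f : H) (m : M), IsMul φ f (j m) → f ∈ LinearMap.range j ⊔ F

end

open scoped ComplexConjugate

/-! ### Taylor coefficients of inner functions -/

/-! The proof iterates a division algorithm in `M`. Split `m = Q m + P m`, with `P` the orthogonal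
projection onto `M ∩ φH` (in the second case `P m = m`), and divide: `P m = φ (A m + f)` with `A m ∈
M`, `f ∈ F`. Let `B m` collect the coordinates of `Q m` and `f` in the given bases. The norm
hypothesis and Pythagoras give `‖A m‖² + ‖B m‖² ≤ ‖m‖²`, hence `∑ ‖B Aⁿ m‖² ≤ ‖m‖²` and `‖Aⁿ m‖ ≤
‖m‖`.

Since `φ` is inner, `T_φ` is an isometry; since `φ(0) = 0`, the constants are orthogonal to its
range. So the spaces `φⁿ K` are mutually orthogonal, and `V m = ∑ φⁿ B Aⁿ m` defines a contraction
from `M` to `H²(𝔻, K)`. Iterating the division at `z` leaves the remainder `φ(z)ⁿ (Aⁿ m)(z)`, which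
tends to zero, so `m(z)` is a linear functional of `(V m)(z)`. Thus `V` is injective. Moreover `T_φ*
V = V A`, because `T_φ*` kills the constants and lowers the power of `φ` in the other terms. Take `N
= range V` and `G = V⁻¹`.

The main steps are `IsInner.exists_coeff` and `IsInner.exists_isometry` (the isometry),
`exists_division` (the algorithm) and `IsInner.exists_model` (the iteration). -/

theorem integral_exp_int_mul_I (m : ℤ) :
    ∫ t in (0 : ℝ)..2 * Real.pi, exp (m * t * I) = if m = 0 then 2 * (Real.pi : ℂ) else 0 := by
  split_ifs with h
  · simp [h]
  · have hc : (m * I : ℂ) ≠ 0 := by simp [h]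
    have := integral_exp_mul_complex (a := 0) (b := 2 * Real.pi) hc
    simp only [mul_right_comm (m : ℂ) _ I, this]
    have h1 : (m * I * ((2 * Real.pi : ℝ) : ℂ)) = m * (2 * Real.pi * I) := by
      push_cast; ring
    rw [h1, exp_int_mul_two_pi_mul_I]
    simp

theorem hasSum_intervalIntegral_of_norm_le {a b : ℝ} {F : ℕ → ℝ → ℂ} {f : ℝ → ℂ} {B : ℕ → ℝ}
    (hF : ∀ n, Continuous (F n)) (hB : ∀ n t, ‖F n t‖ ≤ B n) (hs : Summable B)
    (hf : ∀ t, HasSum (fun n => F n t) (f t)) :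
    HasSum (fun n => ∫ t in a..b, F n t) (∫ t in a..b, f t) :=
  intervalIntegral.hasSum_integral_of_dominated_convergence (fun n _ => B n)
    (fun n => (hF n).aestronglyMeasurable) (fun n => .of_forall fun t _ => hB n t)
    (.of_forall fun _ _ => hs) intervalIntegrable_const (.of_forall fun t _ => hf t)

theorem norm_ofReal_mul_exp {r : ℝ} (hr : 0 ≤ r) (t : ℝ) : ‖(r * exp (t * I) : ℂ)‖ = r := by
  simp [norm_exp_ofReal_mul_I, abs_of_nonneg hr]

section
variable {φ : ℂ → ℂ} {a : ℕ → ℂ}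
  (ha : ∀ z : ℂ, ‖z‖ < 1 → HasSum (fun n => a n * z ^ n) (φ z))
include ha

theorem summable_norm_coeff_mul_pow {r : ℝ} (hr : 0 ≤ r) (hr1 : r < 1) :
    Summable fun n => ‖a n‖ * r ^ n := by
  have h := (ha r (by simpa [abs_of_nonneg hr] using hr1)).summable.norm
  simpa [abs_of_nonneg hr] using h

theorem integral_circle_mul_exp {r : ℝ} (hr : 0 ≤ r) (hr1 : r < 1) (m : ℕ) :
    ∫ t in (0 : ℝ)..2 * Real.pi, φ (r * exp (t * I)) * exp (-(m * t * I)) =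
      2 * Real.pi * (a m * r ^ m) := by
  have hterm : ∀ (n : ℕ) (t : ℝ), a n * (r * exp (t * I)) ^ n * exp (-(m * t * I)) =
      a n * r ^ n * exp (((n - m : ℤ) : ℂ) * t * I) := by
    intro n t
    have : exp (((n - m : ℤ) : ℂ) * t * I) = exp (n * (t * I)) * exp (-(m * t * I)) := by
      rw [← exp_add]; congr 1; push_cast; ring
    rw [this, mul_pow, ← exp_nat_mul]; ring
  have h := hasSum_intervalIntegral_of_norm_le (a := 0) (b := 2 * Real.pi)
    (F := fun n t => a n * (r * exp (t * I)) ^ n * exp (-(m * t * I)))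
    (f := fun t => φ (r * exp (t * I)) * exp (-(m * t * I)))
    (B := fun n => ‖a n‖ * r ^ n) (fun n => by fun_prop)
    (fun n t => by
      rw [hterm, norm_mul, norm_mul, norm_pow, norm_real, Real.norm_of_nonneg hr]
      have : ‖exp (((n - m : ℤ) : ℂ) * t * I)‖ = 1 := by
        have := norm_exp_ofReal_mul_I (((n - m : ℤ) : ℝ) * t)
        push_cast at this ⊢
        exact this
      rw [this, mul_one])
    (summable_norm_coeff_mul_pow ha hr hr1)
    (fun t => (ha _ (by rw [norm_ofReal_mul_exp hr]; exact hr1)).mul_right _)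
  refine h.unique ?_
  simp_rw [hterm, intervalIntegral.integral_const_mul, integral_exp_int_mul_I]
  convert hasSum_ite_eq m (2 * Real.pi * (a m * r ^ m) : ℂ) using 2 with n
  by_cases hnm : n = m
  · subst hnm; simp [mul_comm]
  · have : (n - m : ℤ) ≠ 0 := by omega
    simp [this, hnm]

/-- In `|φ|² = conj φ · φ` only the conjugate factor is expanded. Each term is then a single Fourier
coefficient of `φ` on the circle, and no double series arises. -/
theorem hasSum_coeff_circle (hc : ContinuousOn φ (Metric.ball 0 1)) {C : ℝ}
    (hC : ∀ z ∈ Metric.ball (0 : ℂ) 1, ‖φ z‖ ≤ C) {r : ℝ} (hr : 0 ≤ r) (hr1 : r < 1) (k : ℕ) :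
    HasSum (fun n => 2 * Real.pi * (conj (a n) * a (n + k) * (r ^ n * r ^ (n + k)) : ℂ))
      (∫ t in (0 : ℝ)..2 * Real.pi, (‖φ (r * exp (t * I))‖ ^ 2 : ℝ) * exp (-(k * t * I))) := by
  have hmem : ∀ t : ℝ, (r * exp (t * I) : ℂ) ∈ Metric.ball (0 : ℂ) 1 := fun t => by
    rw [mem_ball_zero_iff, norm_ofReal_mul_exp hr]; exact hr1
  have hψ : Continuous fun t : ℝ => φ (r * exp (t * I)) :=
    hc.comp_continuous (by fun_prop) hmem
  have hconj : ∀ (n : ℕ) (t : ℝ), conj ((r * exp (t * I)) ^ n) = r ^ n * exp (-(n * t * I)) := by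
    intro n t
    rw [mul_pow, ← exp_nat_mul, map_mul, map_pow, conj_ofReal, ← exp_conj]
    congr 2
    simp [mul_assoc]
  have h := hasSum_intervalIntegral_of_norm_le (a := 0) (b := 2 * Real.pi)
    (F := fun n t => conj (a n * (r * exp (t * I)) ^ n) *
      (φ (r * exp (t * I)) * exp (-(k * t * I))))
    (f := fun t => (‖φ (r * exp (t * I))‖ ^ 2 : ℝ) * exp (-(k * t * I)))
    (B := fun n => ‖a n‖ * r ^ n * C)
    (fun n => by
      refine (continuous_conj.comp ?_).mul (hψ.mul ?_) <;> fun_prop)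
    (fun n t => by
      have h1 : ‖exp (-(k * t * I))‖ = 1 := by
        have := norm_exp_ofReal_mul_I (-(k * t))
        push_cast at this
        rwa [neg_mul] at this
      rw [norm_mul, norm_mul, h1, mul_one, RCLike.norm_conj, norm_mul, norm_pow,
        norm_ofReal_mul_exp hr]
      gcongr
      exact hC _ (hmem t))
    ((summable_norm_coeff_mul_pow ha hr hr1).mul_right C)
    (fun t => by
      have h1 := ((hasSum_conj'.2 (ha _ (mem_ball_zero_iff.1 (hmem t)))).mul_right
        (φ (r * exp (t * I)) * exp (-(k * t * I))))
      rw [← mul_assoc, ← normSq_eq_conj_mul_self, normSq_eq_norm_sq] at h1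
      exact h1)
  convert! h using 2 with n
  -- The conjugated power contributes `exp(-int)`, which merges with `exp(-ikt)` to select
  -- coefficient `n + k`.
  have : ∀ t : ℝ, conj (a n * (r * exp (t * I)) ^ n) *
      (φ (r * exp (t * I)) * exp (-(k * t * I))) =
      conj (a n) * r ^ n * (φ (r * exp (t * I)) * exp (-((n + k : ℕ) * t * I))) := by
    intro t
    rw [map_mul, hconj]
    have : exp (-((n + k : ℕ) * t * I)) = exp (-(n * t * I)) * exp (-(k * t * I)) := by
      rw [← exp_add]; congr 1; push_cast; ring
    rw [this]; ring
  simp_rw [this, intervalIntegral.integral_const_mul, integral_circle_mul_exp ha hr hr1]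
  ring

/-- The mean of `|φ|²` over the circle of radius `r` is at most `C²`; this bounds each partial sum
of `‖a n‖² r²ⁿ` uniformly in `r`, and `r → 1` finishes. -/
theorem summable_norm_sq_coeff (hc : ContinuousOn φ (Metric.ball 0 1)) {C : ℝ}
    (hC : ∀ z ∈ Metric.ball (0 : ℂ) 1, ‖φ z‖ ≤ C) : Summable fun n => ‖a n‖ ^ 2 := by
  refine summable_of_sum_range_le (c := C ^ 2) (fun n => by positivity) fun N => ?_
  have hlim : Tendsto (fun r : ℝ => ∑ n ∈ Finset.range N, ‖a n‖ ^ 2 * (r ^ n * r ^ n)) (𝓝[<] 1)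
      (𝓝 (∑ n ∈ Finset.range N, ‖a n‖ ^ 2)) := by
    have : Continuous fun r : ℝ => ∑ n ∈ Finset.range N, ‖a n‖ ^ 2 * (r ^ n * r ^ n) := by fun_prop
    simpa using (this.tendsto 1).mono_left nhdsWithin_le_nhds
  refine le_of_tendsto hlim ?_
  have hev : ∀ᶠ r : ℝ in 𝓝[<] 1, r ∈ Set.Ioo (0 : ℝ) 1 := Ioo_mem_nhdsLT one_pos
  filter_upwards [hev] with r hr
  have h := hasSum_coeff_circle ha hc hC hr.1.le hr.2 0
  have hπ := Real.pi_pos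
  have h' : HasSum (fun n => 2 * Real.pi * (‖a n‖ ^ 2 * (r ^ n * r ^ n)))
      (∫ t in (0 : ℝ)..2 * Real.pi, ‖φ (r * exp (t * I))‖ ^ 2) := by
    have e : (fun n => 2 * Real.pi * (conj (a n) * a (n + 0) * (r ^ n * r ^ (n + 0)) : ℂ)) =
        fun n => ((2 * Real.pi * (‖a n‖ ^ 2 * (r ^ n * r ^ n)) : ℝ) : ℂ) := by
      funext n
      rw [add_zero, ← normSq_eq_conj_mul_self, normSq_eq_norm_sq]
      push_cast; ring
    rw [e] at h
    have e2 : (∫ t in (0 : ℝ)..2 * Real.pi,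
        ((‖φ (r * exp (t * I))‖ ^ 2 : ℝ) : ℂ) * exp (-((0 : ℕ) * t * I))) =
        ((∫ t in (0 : ℝ)..2 * Real.pi, ‖φ (r * exp (t * I))‖ ^ 2 : ℝ) : ℂ) := by
      rw [← intervalIntegral.integral_ofReal]
      simp
    rw [e2] at h
    exact_mod_cast h
  have hb : (∫ t in (0 : ℝ)..2 * Real.pi, ‖φ (r * exp (t * I))‖ ^ 2) ≤ 2 * Real.pi * C ^ 2 := by
    refine (Real.le_norm_self _).trans ?_
    refine (intervalIntegral.norm_integral_le_of_norm_le_const (C := C ^ 2) fun t _ => ?_).trans ?_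
    · rw [norm_pow, norm_norm]
      have := hC (r * exp (t * I)) (by
        rw [mem_ball_zero_iff, norm_ofReal_mul_exp hr.1.le]; exact hr.2)
      gcongr
    · rw [sub_zero, abs_of_pos (by positivity), mul_comm]
  have hle := (sum_le_hasSum (Finset.range N) (fun n _ => by have := hr.1; positivity) h').trans hb
  rw [← Finset.mul_sum] at hle
  exact le_of_mul_le_mul_left hle (by positivity)

end

theorem summable_mul_shift {a : ℕ → ℂ} (h : Summable fun n => ‖a n‖ ^ 2) (k : ℕ) :
    Summable fun n => ‖a n‖ * ‖a (n + k)‖ := by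
  have h2 : Summable fun n => ‖a (n + k)‖ ^ 2 :=
    h.comp_injective (add_left_injective k)
  refine (h.add h2).of_nonneg_of_le (fun n => by positivity) fun n => ?_
  nlinarith [sq_nonneg (‖a n‖ - ‖a (n + k)‖), sq_nonneg (‖a n‖), sq_nonneg (‖a (n + k)‖)]

/-- The Taylor coefficients of an inner function are orthonormal to their shifts. -/
theorem IsInner.exists_coeff {φ : ℂ → ℂ} (hφ : IsInner φ) :
    ∃ a : ℕ → ℂ, (∀ z : ℂ, ‖z‖ < 1 → HasSum (fun n => a n * z ^ n) (φ z)) ∧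
      (Summable fun n => ‖a n‖ ^ 2) ∧
      ∀ k, HasSum (fun n => conj (a n) * a (n + k)) (if k = 0 then 1 else 0) := by
  obtain ⟨C, hC⟩ := hφ.bounded
  have hd : DifferentiableOn ℂ φ (Metric.ball 0 1) := hφ.analytic.differentiableOn
  obtain ⟨a, ha⟩ : ∃ a : ℕ → ℂ, ∀ z : ℂ, ‖z‖ < 1 → HasSum (fun n => a n * z ^ n) (φ z) := by
    refine ⟨fun n => (n.factorial : ℂ)⁻¹ * iteratedDeriv n φ 0, fun z hz => ?_⟩
    convert! Complex.hasSum_taylorSeries_on_ball hd (mem_ball_zero_iff.2 hz) using 2 with n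
    simp only [smul_eq_mul, sub_zero]; ring
  have hs := summable_norm_sq_coeff ha hd.continuousOn hC
  refine ⟨a, ha, hs, fun k => ?_⟩
  have hsk := summable_mul_shift hs k
  have hsum : Summable fun n => conj (a n) * a (n + k) :=
    Summable.of_norm (by simpa using hsk)
  have hev : ∀ᶠ r : ℝ in 𝓝[<] 1, r ∈ Set.Ioo (0 : ℝ) 1 := Ioo_mem_nhdsLT one_pos
  have hC0 : 0 ≤ C := (norm_nonneg _).trans (hC 0 (by simp))
  have hexp : ∀ t : ℝ, ‖exp (-(k * t * I))‖ = 1 := fun t => by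
    have := norm_exp_ofReal_mul_I (-(k * t))
    push_cast at this
    rwa [neg_mul] at this
  have l1 : Tendsto (fun r : ℝ => ∑' n, 2 * Real.pi *
      (conj (a n) * a (n + k) * (r ^ n * r ^ (n + k)) : ℂ)) (𝓝[<] 1)
      (𝓝 (∑' n, 2 * Real.pi * (conj (a n) * a (n + k)))) := by
    refine tendsto_tsum_of_dominated_convergence (hsk.mul_left (2 * Real.pi)) (fun n => ?_) ?_
    · have : Continuous fun r : ℝ =>
        2 * Real.pi * (conj (a n) * a (n + k) * (r ^ n * r ^ (n + k)) : ℂ) := by fun_prop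
      simpa using (this.tendsto 1).mono_left nhdsWithin_le_nhds
    · filter_upwards [hev] with r hr n
      have h1 : r ^ n * r ^ (n + k) ≤ 1 :=
        mul_le_one₀ (pow_le_one₀ hr.1.le hr.2.le) (pow_nonneg hr.1.le _)
          (pow_le_one₀ hr.1.le hr.2.le)
      simp only [norm_mul, norm_pow, RCLike.norm_conj, norm_real, Real.norm_of_nonneg hr.1.le,
        Real.norm_of_nonneg Real.pi_pos.le, RCLike.norm_ofNat]
      have := Real.pi_pos
      refine mul_le_mul_of_nonneg_left ?_ (by positivity)
      exact mul_le_of_le_one_right (by positivity) h1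
  -- Only `|φ|²` occurs in the integrand, so radial limits of the modulus suffice and boundary
  -- values of `φ` itself are not needed.
  have l2 : Tendsto (fun r : ℝ => ∫ t in (0 : ℝ)..2 * Real.pi,
      ((‖φ (r * exp (t * I))‖ ^ 2 : ℝ) : ℂ) * exp (-(k * t * I))) (𝓝[<] 1)
      (𝓝 (∫ t in (0 : ℝ)..2 * Real.pi, exp (-(k * t * I)))) := by
    refine intervalIntegral.tendsto_integral_filter_of_dominated_convergence (fun _ => C ^ 2)
      ?_ ?_ intervalIntegrable_const ?_
    · filter_upwards [hev] with r hr
      refine Continuous.aestronglyMeasurable ?_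
      have : Continuous fun t : ℝ => φ (r * exp (t * I)) :=
        hd.continuousOn.comp_continuous (by fun_prop) fun t => by
          rw [mem_ball_zero_iff, norm_ofReal_mul_exp hr.1.le]; exact hr.2
      exact (continuous_ofReal.comp (this.norm.pow 2)).mul (by fun_prop)
    · filter_upwards [hev] with r hr
      refine .of_forall fun t _ => ?_
      rw [norm_mul, hexp, mul_one, norm_real, norm_pow, norm_norm]
      have := hC (r * exp (t * I)) (by
        rw [mem_ball_zero_iff, norm_ofReal_mul_exp hr.1.le]; exact hr.2)
      gcongr
    · filter_upwards [hφ.radial] with t ht _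
      have h1 : Tendsto (fun r : ℝ => ((‖φ (r * exp (t * I))‖ ^ 2 : ℝ) : ℂ)) (𝓝[<] 1) (𝓝 1) := by
        have := (continuous_ofReal.tendsto _).comp (ht.pow 2)
        simpa [Function.comp_def] using this
      simpa using h1.mul_const (exp (-(k * t * I)))
  have heq : ∑' n, 2 * Real.pi * (conj (a n) * a (n + k)) =
      ∫ t in (0 : ℝ)..2 * Real.pi, exp (-(k * t * I)) := by
    refine tendsto_nhds_unique l1 (l2.congr' ?_)
    filter_upwards [hev] with r hr
    exact (hasSum_coeff_circle ha hd.continuousOn hC hr.1.le hr.2 k).tsum_eq.symm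
  have hint := integral_exp_int_mul_I (-k)
  have : ∀ t : ℝ, exp (((-k : ℤ) : ℂ) * t * I) = exp (-(k * t * I)) := fun t => by
    congr 1; push_cast; ring
  simp_rw [this] at hint
  rw [hint, tsum_mul_left] at heq
  have hπ : (2 * Real.pi : ℂ) ≠ 0 := by simp [Real.pi_ne_zero]
  have key : ∑' n, conj (a n) * a (n + k) = if k = 0 then 1 else 0 := by
    refine mul_left_cancel₀ hπ (heq.trans ?_)
    by_cases hk : k = 0 <;> simp [hk]
  exact key ▸ hsum.hasSum
/-! ### Analytic Toeplitz operators with inner symbol -/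

section
variable {K : Type*} [NormedAddCommGroup K] [InnerProductSpace ℂ K]

namespace HardySpace

omit [InnerProductSpace ℂ K] in
theorem summable_norm_sq (f : HardySpace K) : Summable fun m => ‖f m‖ ^ 2 := by
  simpa using (lp.memℓp f).summable (by norm_num)

omit [InnerProductSpace ℂ K] in
theorem norm_sq_eq_tsum (f : HardySpace K) : ‖f‖ ^ 2 = ∑' m, ‖f m‖ ^ 2 := by
  simpa using lp.norm_rpow_eq_tsum (by norm_num) f

/-- The element of `H²(𝔻, K)` with a given square summable sequence of coefficients. -/
def ofSeq (b : ℕ → K) (hb : Summable fun m => ‖b m‖ ^ 2) : HardySpace K :=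
  ⟨b, memℓp_gen (by simpa using hb)⟩

omit [InnerProductSpace ℂ K] in
@[simp]
theorem ofSeq_apply (b : ℕ → K) (hb : Summable fun m => ‖b m‖ ^ 2) (m : ℕ) :
    ofSeq b hb m = b m := rfl

theorem eval_zero (f : HardySpace K) : f.eval 0 = f 0 := by
  rw [eval, tsum_eq_single 0 fun m hm => by simp [hm]]
  simp

variable [CompleteSpace K]

/-- Evaluation at a point of the disc as a bounded operator on `H²(𝔻, K)`. -/
noncomputable def evalCLM (K : Type*) [NormedAddCommGroup K] [InnerProductSpace ℂ K]
    [CompleteSpace K] (z : 𝔻) : HardySpace K →L[ℂ] K :=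
  LinearMap.mkContinuous
    { toFun := fun f => f.eval z
      map_add' := fun f g => by
        refine (hasSum_eval (f + g) z).unique ?_
        simpa [smul_add] using (hasSum_eval f z).add (hasSum_eval g z)
      map_smul' := fun c f => by
        refine (hasSum_eval (c • f) z).unique ?_
        simpa [smul_comm c] using (hasSum_eval f z).const_smul c }
    (∑' m : ℕ, ‖(z : ℂ)‖ ^ m) fun f => by
      have hs := summable_geometric_of_lt_one (norm_nonneg _) z.norm_lt_one
      rw [← tsum_mul_right]
      refine tsum_of_norm_bounded (hs.mul_right ‖f‖).hasSum fun m => ?_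
      rw [norm_smul, norm_pow]
      gcongr
      exact lp.norm_apply_le_norm (by norm_num) f m

@[simp]
theorem evalCLM_apply (z : 𝔻) (f : HardySpace K) : evalCLM K z f = f.eval z := rfl

end HardySpace

open HardySpace

theorem hasSum_norm_sq_of_hasSum_conj_mul {c : ℕ → ℂ}
    (hc : HasSum (fun m => conj (c m) * c m) 1) : HasSum (fun m => ‖c m‖ ^ 2) 1 := by
  simp_rw [← normSq_eq_conj_mul_self, normSq_eq_norm_sq] at hc
  have h : HasSum (fun m => ((‖c m‖ ^ 2 : ℝ) : ℂ)) ((1 : ℝ) : ℂ) := by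
    simpa only [ofReal_one] using hc
  exact Complex.hasSum_ofReal.1 h

theorem summable_norm_sq_smul {c : ℕ → ℂ} (hc : HasSum (fun m => conj (c m) * c m) 1) (x : K) :
    Summable fun m => ‖c m • x‖ ^ 2 := by
  simpa [norm_smul, mul_pow] using
    (hasSum_norm_sq_of_hasSum_conj_mul hc).summable.mul_right (‖x‖ ^ 2)

theorem inner_ofSeq_smul {c d : ℕ → ℂ} (hc : HasSum (fun m => conj (c m) * c m) 1)
    (hd : HasSum (fun m => conj (d m) * d m) 1) {s : ℂ}
    (hs : HasSum (fun m => conj (c m) * d m) s) (x y : K) :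
    ⟪ofSeq (fun m => c m • x) (summable_norm_sq_smul hc x),
      ofSeq (fun m => d m • y) (summable_norm_sq_smul hd y)⟫ = s * ⟪x, y⟫ := by
  refine (lp.hasSum_inner _ _).unique ?_
  refine Eq.subst (motive := fun F => HasSum F _) (funext fun m => ?_) (hs.mul_right ⟪x, y⟫)
  rw [ofSeq_apply, ofSeq_apply, inner_smul_left, inner_smul_right, mul_assoc]

/-- The isometry `x ↦ (c₀ x, c₁ x, …)` attached to a scalar sequence `c` of norm one. -/
noncomputable def smulIsometry (K : Type*) [NormedAddCommGroup K] [InnerProductSpace ℂ K]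
    (c : ℕ → ℂ) (hc : HasSum (fun m => conj (c m) * c m) 1) : K →ₗᵢ[ℂ] HardySpace K :=
  LinearMap.isometryOfInner
    { toFun := fun x => ofSeq (fun m => c m • x) (summable_norm_sq_smul hc x)
      map_add' := fun x y => by ext m; simp [smul_add]
      map_smul' := fun r x => by ext m; simp [smul_comm r] }
    fun x y => by simpa using inner_ofSeq_smul hc hc hc x y

/-- The coefficients of `z ^ k φ(z)`, where `φ` has coefficients `a`. -/
def shiftSeq (a : ℕ → ℂ) (k m : ℕ) : ℂ := if k ≤ m then a (m - k) else 0

/-- For `l ≤ k`, the substitution `m = n + k` turns the sum into the autocorrelation of `a` at lag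
`k - l`; the other case follows by conjugation. -/
theorem hasSum_conj_shiftSeq_mul {a : ℕ → ℂ}
    (ha : ∀ k, HasSum (fun n => conj (a n) * a (n + k)) (if k = 0 then 1 else 0)) (k l : ℕ) :
    HasSum (fun m => conj (shiftSeq a k m) * shiftSeq a l m) (if k = l then 1 else 0) := by
  wlog hkl : l ≤ k generalizing k l
  · have h := hasSum_conj'.2 (this l k (by omega))
    rw [if_neg (by omega), map_zero] at h
    rw [if_neg (by omega)]
    refine Eq.subst (motive := fun F => HasSum F _) (funext fun m => ?_) h
    rw [map_mul, conj_conj, mul_comm]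
  obtain ⟨d, rfl⟩ := Nat.exists_eq_add_of_le hkl
  have h0 : ∀ m ∉ Set.range (fun n => n + (l + d)),
      conj (shiftSeq a (l + d) m) * shiftSeq a l m = 0 := by
    intro m hm
    have : ¬ l + d ≤ m := fun h => hm ⟨m - (l + d), by simp; omega⟩
    simp [shiftSeq, this]
  rw [← (add_left_injective (l + d)).hasSum_iff h0]
  convert! ha d using 2 with n
  · have e : n + (l + d) - l = n + d := by omega
    simp [shiftSeq, e, show l ≤ n + (l + d) by omega]
  · simp

theorem hasSum_pow_mul_shiftSeq {φ : ℂ → ℂ} {a : ℕ → ℂ} {z : ℂ}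
    (ha : HasSum (fun n => a n * z ^ n) (φ z)) (k : ℕ) :
    HasSum (fun m => z ^ m * shiftSeq a k m) (z ^ k * φ z) := by
  have h0 : ∀ m ∉ Set.range (fun n => n + k), z ^ m * shiftSeq a k m = 0 := by
    intro m hm
    have : ¬ k ≤ m := fun h => hm ⟨m - k, by simp; omega⟩
    simp [shiftSeq, this]
  rw [← (add_left_injective k).hasSum_iff h0]
  convert! ha.mul_left (z ^ k) using 2 with n
  simp [shiftSeq, pow_add]
  ring

theorem isometry_pow_add_apply (T : HardySpace K →ₗᵢ[ℂ] HardySpace K) (m n : ℕ)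
    (f : HardySpace K) : (T ^ (m + n)) f = (T ^ m) ((T ^ n) f) := by
  rw [pow_add]; rfl

theorem isometry_pow_succ_apply (T : HardySpace K →ₗᵢ[ℂ] HardySpace K) (n : ℕ)
    (f : HardySpace K) : (T ^ (n + 1)) f = T ((T ^ n) f) := by
  rw [pow_succ']; rfl

/-- Multiplication by an inner function is an isometry of `H²(𝔻, K)`. -/
theorem IsInner.exists_isometry {φ : ℂ → ℂ} (hφ : IsInner φ) (K : Type*) [NormedAddCommGroup K]
    [InnerProductSpace ℂ K] [CompleteSpace K] :
    ∃ T : HardySpace K →ₗᵢ[ℂ] HardySpace K, ∀ f z, (T f).eval z = φ z • f.eval z := by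
  obtain ⟨a, ha, -, hort⟩ := hφ.exists_coeff
  have hc : ∀ k, HasSum (fun m => conj (shiftSeq a k m) * shiftSeq a k m) 1 := fun k => by
    simpa using hasSum_conj_shiftSeq_mul hort k k
  have hV : OrthogonalFamily ℂ (fun _ : ℕ => K) fun k => smulIsometry K (shiftSeq a k) (hc k) := by
    intro k l hkl x y
    have := inner_ofSeq_smul (hc k) (hc l) (hasSum_conj_shiftSeq_mul hort k l) x y
    rw [if_neg hkl, zero_mul] at this
    exact this
  -- The operator is `f ↦ ∑ (z ^ k φ) f_k`, an isometry because its summands lie in mutually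
  -- orthogonal copies of `K`.
  refine ⟨hV.linearIsometry, fun f z => ?_⟩
  have h := (hV.hasSum_linearIsometry f).mapL (evalCLM K z)
  refine h.unique ?_
  convert (hasSum_eval f z).const_smul (φ z) using 2 with k
  rw [evalCLM_apply]
  refine (hasSum_eval _ z).unique ?_
  have := (hasSum_pow_mul_shiftSeq (ha z z.norm_lt_one) k).smul_const (f k)
  rw [mul_comm, mul_smul] at this
  simpa [smulIsometry, mul_smul] using this

/-- The constant functions in `H²(𝔻, K)`. -/
noncomputable def constIsometry (K : Type*) [NormedAddCommGroup K] [InnerProductSpace ℂ K] :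
    K →ₗᵢ[ℂ] HardySpace K :=
  { toLinearMap := lp.lsingle (𝕜 := ℂ) (E := fun _ : ℕ => K) 2 0
    norm_map' := fun x => lp.norm_single (E := fun _ : ℕ => K) (by norm_num) 0 x }

theorem constIsometry_apply (x : K) : constIsometry K x = lp.single 2 0 x := rfl

theorem eval_constIsometry (x : K) (z : 𝔻) : (constIsometry K x).eval z = x := by
  rw [eval, tsum_eq_single 0]
  · simp [constIsometry_apply]
  · intro m hm
    rw [constIsometry_apply, lp.single_apply_ne _ _ _ hm, smul_zero]

/-! ### Constants as a wandering subspace for `T_φ` -/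

section
variable {φ : ℂ → ℂ} {T : HardySpace K →ₗᵢ[ℂ] HardySpace K}
  (hT : ∀ f z, (T f).eval z = φ z • f.eval z)
include hT

theorem eval_isometry_pow (n : ℕ) (f : HardySpace K) (z : 𝔻) :
    ((T ^ n) f).eval z = φ z ^ n • f.eval z := by
  induction n with
  | zero => simp
  | succ n ih => rw [isometry_pow_succ_apply, hT, ih, smul_smul, ← pow_succ']

theorem inner_constIsometry_isometry (hφ0 : φ 0 = 0) (x : K) (f : HardySpace K) :
    ⟪constIsometry K x, T f⟫ = 0 := by
  have : T f 0 = 0 := by rw [← eval_zero, hT]; simp [hφ0]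
  rw [constIsometry_apply, lp.inner_single_left, this, inner_zero_right]

/-- Cancelling the common power of the isometry reduces this to the orthogonality of constants to
the range of `T`. -/
theorem orthogonalFamily_isometry_pow (hφ0 : φ 0 = 0) :
    OrthogonalFamily ℂ (fun _ : ℕ => K) fun n => (T ^ n).comp (constIsometry K) := by
  have key : ∀ (k d : ℕ) (x y : K),
      ⟪(T ^ k) (constIsometry K x), (T ^ (k + (d + 1))) (constIsometry K y)⟫ = 0 := by
    intro k d x y
    rw [isometry_pow_add_apply, LinearIsometry.inner_map_map, isometry_pow_succ_apply]
    exact inner_constIsometry_isometry hT hφ0 x _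
  intro k l hkl x y
  dsimp only
  rcases lt_or_gt_of_ne hkl with h | h
  · obtain ⟨d, rfl⟩ := Nat.exists_eq_add_of_lt h
    exact key k d x y
  · obtain ⟨d, rfl⟩ := Nat.exists_eq_add_of_lt h
    rw [← inner_conj_symm]
    exact (congrArg _ (key l d y x)).trans (map_zero _)

theorem adjoint_constIsometry [CompleteSpace K] (hφ0 : φ 0 = 0) (x : K) :
    ContinuousLinearMap.adjoint T.toContinuousLinearMap (constIsometry K x) = 0 := by
  refine ext_inner_right ℂ fun f => ?_
  rw [ContinuousLinearMap.adjoint_inner_left, inner_zero_left]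
  exact inner_constIsometry_isometry hT hφ0 x f

end

theorem adjoint_isometry_apply [CompleteSpace K] (T : HardySpace K →ₗᵢ[ℂ] HardySpace K) (f : HardySpace K) :
    ContinuousLinearMap.adjoint T.toContinuousLinearMap (T f) = f := by
  refine ext_inner_right ℂ fun g => ?_
  rw [ContinuousLinearMap.adjoint_inner_left]
  exact T.inner_map_map f g

/-- The powers `φⁿ` are orthonormal in `H²(𝔻, ℂ)`, and `φ(z)ⁿ` is the inner product of `φⁿ` with the
kernel representing evaluation at `z`; Bessel's inequality makes these square summable. -/
theorem IsInner.tendsto_pow {φ : ℂ → ℂ} (hφ : IsInner φ) (hφ0 : φ 0 = 0) (z : 𝔻) :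
    Tendsto (fun n : ℕ => φ z ^ n) atTop (𝓝 0) := by
  obtain ⟨T, hT⟩ := hφ.exists_isometry ℂ
  have hV := orthogonalFamily_isometry_pow hT hφ0
  have ho : Orthonormal ℂ fun n : ℕ => (T ^ n) (constIsometry ℂ 1) :=
    ⟨fun n => by simp, fun k l hkl => hV hkl 1 1⟩
  have hs := ho.inner_products_summable
    ((InnerProductSpace.toDual ℂ (HardySpace ℂ)).symm (evalCLM ℂ z))
  have h0 := hs.tendsto_atTop_zero
  have e : ∀ n : ℕ, ‖⟪(T ^ n) (constIsometry ℂ 1),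
      (InnerProductSpace.toDual ℂ (HardySpace ℂ)).symm (evalCLM ℂ z)⟫‖ = ‖φ z ^ n‖ := by
    intro n
    rw [norm_inner_symm, InnerProductSpace.toDual_symm_apply, evalCLM_apply,
      eval_isometry_pow hT, eval_constIsometry, smul_eq_mul, mul_one]
  simp_rw [e] at h0
  rw [tendsto_zero_iff_norm_tendsto_zero]
  simpa [Real.sqrt_sq (norm_nonneg _)] using h0.sqrt

/-! ### The model attached to a contractive division algorithm -/

section
variable {M : Type*} [NormedAddCommGroup M] [InnerProductSpace ℂ M]
  {A : M →ₗ[ℂ] M} {B : M →ₗ[ℂ] K} (hAB : ∀ m, ‖A m‖ ^ 2 + ‖B m‖ ^ 2 ≤ ‖m‖ ^ 2)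
include hAB

theorem norm_sq_pow_add_sum_le (m : M) (n : ℕ) :
    ‖(A ^ n) m‖ ^ 2 + ∑ i ∈ Finset.range n, ‖B ((A ^ i) m)‖ ^ 2 ≤ ‖m‖ ^ 2 := by
  induction n with
  | zero => simp
  | succ n ih =>
    rw [Finset.sum_range_succ, pow_succ' A, Module.End.mul_apply]
    linarith [hAB ((A ^ n) m)]

theorem sum_norm_sq_iterate_le (m : M) (n : ℕ) :
    ∑ i ∈ Finset.range n, ‖B ((A ^ i) m)‖ ^ 2 ≤ ‖m‖ ^ 2 := by
  linarith [norm_sq_pow_add_sum_le hAB m n, sq_nonneg ‖(A ^ n) m‖]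

theorem summable_norm_sq_iterate (m : M) : Summable fun n => ‖B ((A ^ n) m)‖ ^ 2 :=
  summable_of_sum_range_le (fun _ => by positivity) (sum_norm_sq_iterate_le hAB m)

/-- This is the common mechanism of both cases: `E z` is evaluation on `M`, `A` the quotient
retained in `M`, `B` the recorded data, and `L z` rebuilds a value from that data. Only `K`, `A`,
`B` and `L` differ between the cases. -/
theorem IsInner.exists_model [CompleteSpace K] {φ : ℂ → ℂ} (hφ : IsInner φ) (hφ0 : φ 0 = 0)
    (E : 𝔻 → M →L[ℂ] ℂ) (hE : ∀ m, (∀ z, E z m = 0) → m = 0) (L : 𝔻 → K →L[ℂ] ℂ)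
    (h : ∀ m z, E z m = L z (B m) + φ z * E z (A m)) :
    ∃ N : Submodule ℂ (HardySpace K), InvariantToeplitzAdjoint φ N ∧
      ∃ G : N ≃ₗ[ℂ] M, ∀ q : N,
        (∀ z, E z (G q) = L z ((q : HardySpace K).eval z)) ∧ ‖(q : HardySpace K)‖ ≤ ‖G q‖ := by
  obtain ⟨T, hT⟩ := hφ.exists_isometry K
  have hV := orthogonalFamily_isometry_pow hT hφ0
  let b : M →ₗ[ℂ] HardySpace K :=
    { toFun := fun m => ofSeq (fun n => B ((A ^ n) m)) (summable_norm_sq_iterate hAB m)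
      map_add' := fun x y => by ext n; simp
      map_smul' := fun c x => by ext n; simp }
  let V : M →ₗ[ℂ] HardySpace K := hV.linearIsometry.toLinearMap ∘ₗ b
  have hVsum : ∀ m, HasSum (fun n => (T ^ n) (constIsometry K (B ((A ^ n) m)))) (V m) :=
    fun m => hV.hasSum_linearIsometry (b m)
  have hnorm : ∀ m, ‖V m‖ ≤ ‖m‖ := by
    intro m
    refine le_of_sq_le_sq ?_ (norm_nonneg _)
    have : ‖V m‖ = ‖b m‖ := hV.linearIsometry.norm_map (b m)
    rw [this, norm_sq_eq_tsum]
    exact Real.tsum_le_of_sum_range_le (fun _ => by positivity) (sum_norm_sq_iterate_le hAB m)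
  have heval : ∀ m z, E z m = L z ((V m).eval z) := by
    intro m z
    have h1 := ((hVsum m).mapL (evalCLM K z)).mapL (L z)
    simp only [evalCLM_apply, eval_isometry_pow hT, eval_constIsometry, map_smul,
      smul_eq_mul] at h1
    -- The recursion `h`, applied to `Aⁱ m` and multiplied by `φ(z)ⁱ`, telescopes.
    have h2 : ∀ n, ∑ i ∈ Finset.range n, φ z ^ i * L z (B ((A ^ i) m)) =
        E z m - φ z ^ n * E z ((A ^ n) m) := by
      intro n
      induction n with
      | zero => simp
      | succ n ih =>
        rw [Finset.sum_range_succ, ih, h ((A ^ n) m) z, pow_succ' A, Module.End.mul_apply]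
        ring
    have h3 : Tendsto (fun n => φ z ^ n * E z ((A ^ n) m)) atTop (𝓝 0) := by
      refine Tendsto.zero_mul_isBoundedUnder_le (hφ.tendsto_pow hφ0 z) ?_
      refine isBoundedUnder_of ⟨‖E z‖ * ‖m‖, fun n => ?_⟩
      refine (E z).le_opNorm_of_le (le_of_sq_le_sq ?_ (norm_nonneg _))
      have := norm_sq_pow_add_sum_le hAB m n
      have h0 : 0 ≤ ∑ i ∈ Finset.range n, ‖B ((A ^ i) m)‖ ^ 2 :=
        Finset.sum_nonneg fun _ _ => by positivity
      linarith
    have h4 := h1.tendsto_sum_nat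
    simp_rw [h2] at h4
    have h5 := (tendsto_const_nhds (x := E z m)).sub h3
    rw [sub_zero] at h5
    exact tendsto_nhds_unique h5 h4
  have hinj : Function.Injective V := by
    rw [← LinearMap.ker_eq_bot, LinearMap.ker_eq_bot']
    intro m hm
    refine hE m fun z => ?_
    rw [heval, hm, ← evalCLM_apply, map_zero, map_zero]
  refine ⟨LinearMap.range V, ⟨T.toContinuousLinearMap, hT, ?_⟩,
    (LinearEquiv.ofInjective V hinj).symm, fun q => ?_⟩
  · rintro _ ⟨m, rfl⟩
    refine ⟨A m, ?_⟩
    have h1 := (hVsum m).mapL (ContinuousLinearMap.adjoint T.toContinuousLinearMap)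
    -- The term `n = 0` is a constant, killed by the adjoint; the remaining terms, reindexed, form
    -- the series of `V (A m)`.
    rw [← hasSum_nat_add_iff' 1] at h1
    simp only [Finset.sum_range_one, pow_zero, LinearIsometry.coe_one, id,
      adjoint_constIsometry hT hφ0, sub_zero, isometry_pow_succ_apply,
      adjoint_isometry_apply, pow_succ A, Module.End.mul_apply] at h1
    exact (hVsum (A m)).unique h1
  · obtain ⟨m, rfl⟩ := (LinearEquiv.ofInjective V hinj).surjective q
    rw [LinearEquiv.symm_apply_apply]
    exact ⟨heval m, hnorm m⟩

end

end
/-! ### Division by `φ` in a contractively contained space -/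

section
variable {H : Type*} [NormedAddCommGroup H] [InnerProductSpace ℂ H] [RKHS ℂ H 𝔻 ℂ]

/-- Point evaluation on a reproducing kernel Hilbert space as a bounded functional. -/
noncomputable def evalFunctional (H : Type*) [NormedAddCommGroup H] [InnerProductSpace ℂ H]
    [RKHS ℂ H 𝔻 ℂ] (z : 𝔻) : H →L[ℂ] ℂ :=
  ContinuousLinearMap.proj z ∘L RKHS.coeCLM ℂ

@[simp]
theorem evalFunctional_apply (z : 𝔻) (f : H) : evalFunctional H z f = f z := rfl

namespace IsMul
variable {φ : ℂ → ℂ} {f f' k k' : H}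

theorem add (h : IsMul φ f k) (h' : IsMul φ f' k') : IsMul φ ⇑(f + f') ⇑(k + k') := fun z => by
  simp [h z, h' z, mul_add]

theorem sub (h : IsMul φ f k) (h' : IsMul φ f' k') : IsMul φ ⇑(f - f') ⇑(k - k') := fun z => by
  simp [h z, h' z, mul_sub]

theorem smul (c : ℂ) (h : IsMul φ f k) : IsMul φ ⇑(c • f) ⇑(c • k) := fun z => by
  simp [h z, mul_left_comm]

end IsMul

/-- Quotients of a convergent sequence form a Cauchy sequence by `hbelow`, and continuity of point
evaluations carries the product relation to the limit. -/
theorem isClosed_mulRange [CompleteSpace H] {φ : ℂ → ℂ}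
    (hbelow : ∀ f k : H, IsMul φ f k → ‖f‖ ≤ ‖k‖) : IsClosed (mulRange φ H : Set H) := by
  refine isClosed_of_closure_subset fun k hk => ?_
  obtain ⟨u, hu, hlim⟩ := mem_closure_iff_seq_limit.1 hk
  choose f hf using hu
  have hcauchy : CauchySeq f := by
    have hd : ∀ m n, dist (f m) (f n) ≤ dist (u m) (u n) := fun m n => by
      rw [dist_eq_norm, dist_eq_norm]
      exact hbelow _ _ ((hf m).sub (hf n))
    rw [Metric.cauchySeq_iff]
    intro ε hε
    obtain ⟨N, hN⟩ := Metric.cauchySeq_iff.1 hlim.cauchySeq ε hε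
    exact ⟨N, fun m hm n hn => (hd m n).trans_lt (hN m hm n hn)⟩
  obtain ⟨f₀, hf₀⟩ := cauchySeq_tendsto_of_complete hcauchy
  refine ⟨f₀, fun z => ?_⟩
  have h1 := ((evalFunctional H z).continuous.tendsto k).comp hlim
  have h2 := (((evalFunctional H z).continuous.tendsto f₀).comp hf₀).const_mul (φ z)
  exact tendsto_nhds_unique h1 (h2.congr fun n => (hf n z).symm)

variable {M : Type*} [NormedAddCommGroup M] [InnerProductSpace ℂ M] {j : M →ₗ[ℂ] H}
  {F : Submodule ℂ H} {φ : ℂ → ℂ}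

omit [RKHS ℂ H 𝔻 ℂ] in
theorem sumIncl_add (x y : WithLp 2 (M × F)) :
    sumIncl j F (x + y) = sumIncl j F x + sumIncl j F y := by
  simp [sumIncl]; abel

omit [RKHS ℂ H 𝔻 ℂ] in
theorem sumIncl_sub (x y : WithLp 2 (M × F)) :
    sumIncl j F (x - y) = sumIncl j F x - sumIncl j F y := by
  simp [sumIncl]; abel

omit [RKHS ℂ H 𝔻 ℂ] in
theorem sumIncl_smul (c : ℂ) (x : WithLp 2 (M × F)) :
    sumIncl j F (c • x) = c • sumIncl j F x := by
  simp [sumIncl]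

/-- The norm bound also yields uniqueness: the difference of two quotients of one element is a
quotient of `0`, so its norm is at most `0`. Uniqueness makes the chosen quotient linear. -/
theorem exists_division
    (hdiv : ∀ (f : H) (m : M), IsMul φ f (j m) → f ∈ LinearMap.range j ⊔ F)
    (hnorm : ∀ (x : WithLp 2 (M × F)) (m : M), IsMul φ (⇑(sumIncl j F x)) (j m) → ‖x‖ ≤ ‖m‖) :
    ∃ D : interMulRange φ j →ₗ[ℂ] WithLp 2 (M × F),
      ∀ m, IsMul φ (⇑(sumIncl j F (D m))) (j m) ∧ ‖D m‖ ≤ ‖m‖ := by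
  have hex : ∀ m : interMulRange φ j, ∃ x : WithLp 2 (M × F),
      IsMul φ (⇑(sumIncl j F x)) (j m) := by
    rintro ⟨m, f, hf⟩
    obtain ⟨_, ⟨m', rfl⟩, f', hf', rfl⟩ := Submodule.mem_sup.1 (hdiv f m hf)
    exact ⟨WithLp.toLp 2 (m', ⟨f', hf'⟩), hf⟩
  have huniq : ∀ (x y : WithLp 2 (M × F)) (m : M), IsMul φ (⇑(sumIncl j F x)) (j m) →
      IsMul φ (⇑(sumIncl j F y)) (j m) → x = y := by
    intro x y m hx hy
    have h := hx.sub hy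
    rw [← sumIncl_sub, ← map_sub, sub_self] at h
    have := hnorm _ _ h
    rw [norm_zero] at this
    exact sub_eq_zero.1 (norm_le_zero_iff.1 this)
  choose D hD using hex
  refine ⟨{ toFun := D, map_add' := fun x y => ?_, map_smul' := fun c x => ?_ },
    fun m => ⟨hD m, hnorm _ _ (hD m)⟩⟩
  · refine huniq _ _ _ (hD (x + y)) ?_
    rw [sumIncl_add, Submodule.coe_add, map_add]
    exact (hD x).add (hD y)
  · refine huniq _ _ _ (hD (c • x)) ?_
    rw [sumIncl_smul, Submodule.coe_smul, map_smul]
    exact (hD x).smul c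

end

/-! ### The two representations of `M` -/

theorem norm_sq_eq_fstPart_add_sndPart {I : Type*} {p : ℕ} (q : HardySpace (SumSpace I p)) :
    ‖q‖ ^ 2 = ‖fstPart q‖ ^ 2 + ‖sndPart q‖ ^ 2 := by
  simp only [HardySpace.norm_sq_eq_tsum]
  rw [← (HardySpace.summable_norm_sq _).tsum_add (HardySpace.summable_norm_sq _)]
  exact tsum_congr fun m => WithLp.prod_norm_sq_eq_of_L2 (q m)

theorem theorem5p2
    {H : Type*} [NormedAddCommGroup H] [InnerProductSpace ℂ H] [CompleteSpace H]
    [RKHS ℂ H 𝔻 ℂ] (hH : ∀ f : H, IsAnalyticOnDisc f)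
    (φ : ℂ → ℂ) (hφ : IsInner φ) (hφ0 : φ 0 = 0)
    (hmul : ∀ f : H, ∃ k : H, IsMul φ f k)
    (hbelow : ∀ f k : H, IsMul φ f k → ‖f‖ ≤ ‖k‖)
    (hdiv : ∀ h : 𝔻 → ℂ, IsAnalyticOnDisc h → (∃ k : H, IsMul φ h k) → ∃ f : H, ⇑f = h)
    {M : Type*} [NormedAddCommGroup M] [InnerProductSpace ℂ M] [CompleteSpace M]
    (j : M →ₗ[ℂ] H) (hj : IsContractivelyContained j)
    (F : Submodule ℂ H) (p : ℕ) (hF : IsNearlyInvariantWithDefect φ j F p)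
    (hnorm : ∀ (x : WithLp 2 (M × F)) (m : M), IsMul φ (⇑(sumIncl j F x)) (j m) → ‖x‖ ≤ ‖m‖) :
    (¬ LinearMap.range j ≤ mulRange φ H →
      ∀ (I : Type*) (g : HilbertBasis I ℂ (interMulRange φ j)ᗮ)
        (e : OrthonormalBasis (Fin p) ℂ F),
        ∃ N : Submodule ℂ (HardySpace (SumSpace I p)),
          HardySpace.InvariantToeplitzAdjoint φ N ∧
          ∃ G : N ≃ₗ[ℂ] M, ∀ q : N,
            (∀ z : 𝔻, ∃ s : ℂ,
              HasSum (fun i : I => j (g i : M) z * (fstPart (q : HardySpace (SumSpace I p))).eval z i) s ∧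
              j (G q) z = s + φ z * ∑ i : Fin p, (e i : H) z *
                (sndPart (q : HardySpace (SumSpace I p))).eval z i) ∧
            ‖(q : HardySpace (SumSpace I p))‖ ^ 2 =
              ‖fstPart (q : HardySpace (SumSpace I p))‖ ^ 2 +
                ‖sndPart (q : HardySpace (SumSpace I p))‖ ^ 2 ∧
            ‖(q : HardySpace (SumSpace I p))‖ ^ 2 ≤ ‖G q‖ ^ 2) ∧
    (LinearMap.range j ≤ mulRange φ H →
      ∀ e : OrthonormalBasis (Fin p) ℂ F,
        ∃ N : Submodule ℂ (HardySpace (EuclideanSpace ℂ (Fin p))),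
          HardySpace.InvariantToeplitzAdjoint φ N ∧
          ∃ G : N ≃ₗ[ℂ] M, ∀ t : N,
            (∀ z : 𝔻, j (G t) z = φ z * ∑ i : Fin p, (e i : H) z *
              (t : HardySpace (EuclideanSpace ℂ (Fin p))).eval z i) ∧
            ‖(t : HardySpace (EuclideanSpace ℂ (Fin p)))‖ ≤ ‖G t‖) := by
  let jc : M →L[ℂ] H := j.mkContinuous 1 fun m => by simpa using hj.contractive m
  let E : 𝔻 → M →L[ℂ] ℂ := fun z => evalFunctional H z ∘L jc
  have hE : ∀ m, (∀ z, E z m = 0) → m = 0 := by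
    intro m hm
    refine hj.injective ?_
    rw [map_zero]
    refine RKHS.ext fun z => ?_
    rw [RKHS.coe_zero]
    exact hm z
  obtain ⟨D, hD⟩ := exists_division hF.division hnorm
  have hDsq : ∀ m, ‖(D m).fst‖ ^ 2 + ‖(D m).snd‖ ^ 2 ≤ ‖m‖ ^ 2 := fun m => by
    rw [← WithLp.prod_norm_sq_eq_of_L2]
    have := (hD m).2
    gcongr
  have hDeval : ∀ (m : interMulRange φ j) (z : 𝔻),
      E z m = φ z * (evalFunctional H z (D m).snd) + φ z * E z (D m).fst := by
    intro m z
    have h1 : E z m = φ z * sumIncl j F (D m) z := (hD m).1 z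
    rw [h1, sumIncl, RKHS.coe_add, Pi.add_apply, mul_add, add_comm]
    rfl
  have hsum : ∀ (e : OrthonormalBasis (Fin p) ℂ F) (t : EuclideanSpace ℂ (Fin p)) (z : 𝔻),
      evalFunctional H z (e.repr.symm t : F) = ∑ i, (e i : H) z * t i := by
    intro e t z
    rw [← e.sum_repr_symm]
    simp [-evalFunctional_apply, map_sum]
    simp [mul_comm]
  constructor
  · intro _ I g e
    have : IsClosed (interMulRange φ j : Set M) := (isClosed_mulRange hbelow).preimage jc.continuous
    have : CompleteSpace (interMulRange φ j) := this.completeSpace_coe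
    let P := (interMulRange φ j).orthogonalProjectionOnto
    let Q := (interMulRange φ j)ᗮ.orthogonalProjectionOnto
    let A : M →ₗ[ℂ] M := WithLp.fstₗ 2 ℂ M F ∘ₗ D ∘ₗ P.toLinearMap
    let B : M →ₗ[ℂ] SumSpace I p := (WithLp.linearEquiv 2 ℂ _).symm.toLinearMap ∘ₗ
      (g.repr.toLinearMap ∘ₗ Q.toLinearMap).prod
        (e.repr.toLinearMap ∘ₗ WithLp.sndₗ 2 ℂ M F ∘ₗ D ∘ₗ P.toLinearMap)
    have hB : ∀ m, B m = WithLp.toLp 2 (g.repr (Q m), e.repr (D (P m)).snd) := fun _ => rfl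
    have hA : ∀ m, A m = (D (P m)).fst := fun _ => rfl
    -- The `F`-component carries an extra factor `φ(z)` because it is part of a quotient by `φ`,
    -- whereas the component along the `g i` is split off before dividing.
    let L : 𝔻 → SumSpace I p →L[ℂ] ℂ := fun z =>
      (E z ∘L Submodule.subtypeL _ ∘L g.repr.symm.toContinuousLinearEquiv.toContinuousLinearMap) ∘L
        WithLp.fstL 2 ℂ (lp (fun _ : I => ℂ) 2) (EuclideanSpace ℂ (Fin p)) +
      φ z • (evalFunctional H z ∘L F.subtypeL ∘L
        e.repr.symm.toContinuousLinearEquiv.toContinuousLinearMap) ∘L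
        WithLp.sndL 2 ℂ (lp (fun _ : I => ℂ) 2) (EuclideanSpace ℂ (Fin p))
    have hL : ∀ z x, L z x = E z (g.repr.symm x.fst : (interMulRange φ j)ᗮ) +
      φ z * evalFunctional H z (e.repr.symm x.snd : F) := fun _ _ => rfl
    obtain ⟨N, hN, G, hG⟩ := hφ.exists_model (A := A) (B := B) (fun m => by
      have h1 := hDsq (P m)
      have h2 := (interMulRange φ j).norm_sq_eq_add_norm_sq_projection m
      have h3 : ‖B m‖ ^ 2 = ‖Q m‖ ^ 2 + ‖(D (P m)).snd‖ ^ 2 := by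
        rw [WithLp.prod_norm_sq_eq_of_L2, hB]
        simp
      rw [hA, h3]
      linarith) hφ0 E hE L (fun m z => by
      have h1 : m = (P m : M) + (Q m : M) :=
        ((interMulRange φ j).starProjection_add_starProjection_orthogonal m).symm
      have h2 : E z m = E z (P m : M) + E z (Q m : M) := by rw [← map_add, ← h1]
      rw [h2, hDeval, hL, hB, hA]
      simp only [WithLp.toLp_fst, WithLp.toLp_snd, LinearIsometryEquiv.symm_apply_apply]
      ring)
    refine ⟨N, hN, G, fun q => ⟨fun z => ?_, norm_sq_eq_fstPart_add_sndPart _, ?_⟩⟩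
    · refine ⟨E z (g.repr.symm ((fstPart (q : HardySpace (SumSpace I p))).eval z) :
        (interMulRange φ j)ᗮ), ?_, ?_⟩
      · have h := (g.hasSum_repr_symm ((fstPart (q : HardySpace (SumSpace I p))).eval z)).mapL
          (E z ∘L Submodule.subtypeL _)
        refine Eq.subst (motive := fun F => HasSum F _) (funext fun i => ?_) h
        rw [map_smul, smul_eq_mul, mul_comm]
        rfl
      · rw [← hsum e]
        refine ((hG q).1 z).trans ?_
        rw [hL, fstPart, sndPart, HardySpace.eval_map, HardySpace.eval_map]
        rfl
    · have := (hG q).2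
      gcongr
  · intro hsub e
    have htop : interMulRange φ j = ⊤ :=
      (Submodule.eq_top_iff').2 fun m => hsub (LinearMap.mem_range_self j m)
    -- Every element of `M` is divisible here, so the identity replaces the projection and only the
    -- `F`-component is recorded.
    let ι : M →ₗ[ℂ] interMulRange φ j := LinearMap.id.codRestrict _ fun m => by simp [htop]
    let A : M →ₗ[ℂ] M := WithLp.fstₗ 2 ℂ M F ∘ₗ D ∘ₗ ι
    let B : M →ₗ[ℂ] EuclideanSpace ℂ (Fin p) :=
      e.repr.toLinearMap ∘ₗ WithLp.sndₗ 2 ℂ M F ∘ₗ D ∘ₗ ι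
    have hB : ∀ m, B m = e.repr (D (ι m)).snd := fun _ => rfl
    have hA : ∀ m, A m = (D (ι m)).fst := fun _ => rfl
    let L : 𝔻 → EuclideanSpace ℂ (Fin p) →L[ℂ] ℂ := fun z =>
      φ z • (evalFunctional H z ∘L F.subtypeL ∘L
        e.repr.symm.toContinuousLinearEquiv.toContinuousLinearMap)
    have hL : ∀ z x, L z x = φ z * evalFunctional H z (e.repr.symm x : F) := fun _ _ => rfl
    obtain ⟨N, hN, G, hG⟩ := hφ.exists_model (A := A) (B := B) (fun m => by
      rw [hA, hB, LinearIsometryEquiv.norm_map]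
      exact hDsq (ι m)) hφ0 E hE L (fun m z => by
      rw [hL, hB, hA, LinearIsometryEquiv.symm_apply_apply]
      exact hDeval (ι m) z)
    refine ⟨N, hN, G, fun t => ⟨fun z => ?_, (hG t).2⟩⟩
    rw [← hsum e]
    exact (hG t).1 z
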